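/- **Setting.** Fix a first-order language $\mathscr{L}$: a collection $\mathscr{L}_q$ of quantifier symbols and collections $\mathscr{L}_n$ ($n\in\omega$) of $n$-ary propositional connectives, with designated $e\in\mathscr{L}_0$ and $\otimes\in\mathscr{L}_2$. *Syntax.* A many-sorted signature $Sg$ consists of sorts, typed function symbols $f:\sigma_1,\dots,\sigma_n\to\tau$ and typed relation symbols $R\subseteq\sigma_1,\dots,\sigma_n$. Terms and formulas are taken in context $\Gamma=[x_1:\sigma_1,\dots,x_n:\sigma_n]$, up to renaming of variables. Formulas are built from $R(M_1,\dots,M_n)$ and $M_1=_\sigma M_2$ by the connectives and by $\Omega_{x:\sigma}(\phi)\,[\Gamma]$ for $\Omega\in\mathscr{L}_q$ and $\phi\,[\Gamma,x:\sigma]$. Assertions are equations $M=N:\sigma\,[\Gamma]$ and sequents $\phi_1,\dots,\phi_n\vdash\psi\,[\Gamma]$. An $Sg$-theory is a set of $Sg$-assertions. A logic $\mathcal{L}$ is a closure operator on the lattice of $Sg$-theories for each signature $Sg$; $T\vdash_{\mathcal L}T'$ means that $T'$ is contained in the $\mathcal{L}$-closure of $T$. *Prop-categories.* An object $(\mathcal{C},P)$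 of $\mathbf{FA}$ is a category $\mathcal{C}$ with designated finite products and a functor $P:\mathcal{C}^{op}\to\mathbf{Pos}$ together with the following structure. Each $P(c)$ is an algebra for the connectives (with operations not assumed monotone), each $P(f)$ is a homomorphism, and $(P(c),\otimes,e_c)$ is a monoid, where $e_c$ is the value of $e$ in $P(c)$. There are elements $Eq_c\in P(c\times c)$ and, for $\Omega\in\mathscr{L}_q$, maps of sets $\Omega_{b,c}:P(b\times c)\to P(b)$ natural in $b$. These satisfy $$\Omega_{b,1}\circ P(\pi_1^{b,1})=\mathrm{id},\qquad \Omega_{b,c\times d}\circ P(a_{b,c,d})=\Omega_{b,c}\circ\Omega_{b\times c,d},\qquad Eq_1=e_{1\times1},$$ where $a_{b,c,d}:b\times(c\times d)\to(b\times c)\times d$ is the canonical isomorphism, and, for $c=c_1\times c_2$, $$Eq_c=P(\langle\pi_1^{c_1,c_2}\pi_1^{c,c},\pi_1^{c_1,c_2}\pi_2^{c,c}\rangle)Eq_{c_1}\otimes P(\langle\pi_2^{c_1,c_2}\pi_1^{c,c},\pi_2^{c_1,c_2}\pi_2^{c,c}\rangle)Eq_{c_2}.$$ A morphism $F:(\mathcal{C},P)\to(\mathcal{D},Q)$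 is a finite-product-preserving functor $F^o:\mathcal{C}\to\mathcal{D}$ with a natural transformation $F^p:P\Rightarrow QF^o$ whose components are homomorphisms for the connectives and satisfy $$F^p_b\circ\Omega_{b,c}=\Omega_{F^ob,F^oc}\circ Q(a_{F,b,c}^{-1})\circ F^p_{b\times c},\qquad F^p_{c\times c}(Eq_c)=Q(a_{F,c,c})(Eq_{F^oc}),$$ where $a_{F,b,c}:F^o(b\times c)\to F^ob\times F^oc$ is the canonical isomorphism. Composition is given by $(K\circ F)^o=K^oF^o$ and $(K\circ F)^p_c=K^p_{F^oc}\circ F^p_c$. *Semantics.* An $Sg$-structure in $(\mathcal{C},P)$ assigns objects to sorts, morphisms $[\![\sigma_1]\!]\times\dots\times[\![\sigma_n]\!]\to[\![\tau]\!]$ to function symbols and elements of $P([\![\sigma_1]\!]\times\dots\times[\![\sigma_n]\!])$ to relation symbols. Terms and formulas in context are interpreted recursively as usual: substitution of terms is interpreted by $P$ of the corresponding morphism, $=_\sigma$ by $Eq_{[\![\sigma]\!]}$, connectives by the algebra operations and $\Omega_{x:\sigma}$ by $\Omega_{[\![\Gamma]\!],[\![\sigma]\!]}$. An equation is satisfied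 if both sides have the same interpretation; a sequent is satisfied if $[\![\phi_1]\!]\otimes\dots\otimes[\![\phi_n]\!]\le[\![\psi]\!]$ (the left side being $e_{[\![\Gamma]\!]}$ if $n=0$). $\mathbf{FA}_{\mathcal L}$ is the full subcategory of $\mathbf{FA}$ on those $(\mathcal{C},P)$ such that, whenever $T\vdash_{\mathcal L}T'$, every structure in $(\mathcal{C},P)$ satisfying $T$ satisfies $T'$. **Proposition.** Let $\mathcal{L}$ be a logic. Let $\mathscr{E}$ be the class of morphisms $\epsilon$ of $\mathbf{FA}_{\mathcal L}$ such that $\epsilon^o$ is bijective on objects and full and every $\epsilon^p_c$ is surjective. Let $\mathscr{M}$ be the class of morphisms $\iota$ of $\mathbf{FA}_{\mathcal L}$ such that $\iota^o$ is faithful and every $\iota^p_c$ is an order embedding (subprop-morphisms). Then $(\mathscr{E},\mathscr{M})$ is an orthogonal factorization system on $\mathbf{FA}_{\mathcal L}$. That is, both classes contain all isomorphisms and are closed under composition; every morphism $F$ factors as $F=m\circ e$ with $e\in\mathscr{E}$ and $m\in\mathscr{M}$; and for $e,e'\in\mathscr{E}$, $m,m'\in\mathscr{M}$ and morphisms $u,v$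 with $v\circ m\circ e=m'\circ e'\circ u$ there is a unique morphism $w$ with $w\circ e=e'\circ u$ and $m'\circ w=v\circ m$. -/

import Mathlib

universe l s u v w

namespace PropLogic

open CategoryTheory MonoidalCategory CartesianMonoidalCategory Opposite

/-! ### First-order languages, signatures and well-formed expressions in context -/

/-- A first-order language: quantifier symbols and propositional connectives with arities, with a
designated nullary connective `e` and a designated binary connective `⊗`. -/
structure FOLanguage where
  quant : Type l
  conn : ℕ → Type l
  unit : conn 0
  tensor : conn 2

/-- Contexts `[x₁ : σ₁, …, xₙ : σₙ]`, as lists of sorts growing to the right. The variables are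
nameless: a variable of a context is a position in it. -/
inductive Ctx (S : Type s) : Type s
  | nil : Ctx S
  | snoc (Γ : Ctx S) (σ : S) : Ctx S

/-- `Var Γ σ` is the type of variables (positions) of sort `σ` in the context `Γ`. -/
inductive Var {S : Type s} : Ctx S → S → Type s
  | last {Γ : Ctx S} {σ : S} : Var (Γ.snoc σ) σ
  | weaken {Γ : Ctx S} {σ τ : S} (x : Var Γ σ) : Var (Γ.snoc τ) σ

/-- A many-sorted signature. A function symbol `f : σ₁, …, σₙ → τ` has `fnDom f = [σ₁, …, σₙ]` and
`fnCod f = τ`; a relation symbol `R ⊆ σ₁, …, σₙ` has `relDom R = [σ₁, …, σₙ]`. -/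
structure Signature where
  Srt : Type s
  Fn : Type s
  fnDom : Fn → Ctx Srt
  fnCod : Fn → Srt
  Rel : Type s
  relDom : Rel → Ctx Srt

/-- Terms in context, `M : σ [Γ]`. -/
inductive Term (Sg : Signature.{s}) (Γ : Ctx Sg.Srt) : Sg.Srt → Type s
  | var {σ : Sg.Srt} (x : Var Γ σ) : Term Sg Γ σ
  | app (f : Sg.Fn) (M : ∀ σ : Sg.Srt, Var (Sg.fnDom f) σ → Term Sg Γ σ) : Term Sg Γ (Sg.fnCod f)

/-- Formulas in context, `φ : prop [Γ]`; variables being nameless, these are formulas up to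
renaming of variables. In `quant Ω φ` the last variable of the context of `φ` is bound. -/
inductive Formula (L : FOLanguage.{l}) (Sg : Signature.{s}) : Ctx Sg.Srt → Type (max l s)
  | rel {Γ : Ctx Sg.Srt} (R : Sg.Rel) (M : ∀ σ : Sg.Srt, Var (Sg.relDom R) σ → Term Sg Γ σ) :
      Formula L Sg Γ
  | eq {Γ : Ctx Sg.Srt} {σ : Sg.Srt} (M N : Term Sg Γ σ) : Formula L Sg Γ
  | conn {Γ : Ctx Sg.Srt} {n : ℕ} (d : L.conn n) (φ : Fin n → Formula L Sg Γ) : Formula L Sg Γ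
  | quant {Γ : Ctx Sg.Srt} {σ : Sg.Srt} (Ω : L.quant) (φ : Formula L Sg (Γ.snoc σ)) :
      Formula L Sg Γ

/-- Assertions: equations in context `M = N : σ [Γ]` and sequents in context
`φ₁, …, φₙ ⊢ ψ [Γ]`. -/
inductive Assertion (L : FOLanguage.{l}) (Sg : Signature.{s}) : Type (max l s)
  | eqn (Γ : Ctx Sg.Srt) (σ : Sg.Srt) (M N : Term Sg Γ σ) : Assertion L Sg
  | seq (Γ : Ctx Sg.Srt) (φ : List (Formula L Sg Γ)) (ψ : Formula L Sg Γ) : Assertion L Sg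

/-- `Sg`-theories are sets of `Sg`-assertions, ordered by inclusion. -/
abbrev Theory (L : FOLanguage.{l}) (Sg : Signature.{s}) : Type (max l s) :=
  Set (Assertion L Sg)

/-- A first-order logic: a closure operator on the lattice of `Sg`-theories, for each signature
`Sg`. No derivation rules are imposed. -/
structure Logic (L : FOLanguage.{l}) where
  cl : ∀ Sg : Signature.{s}, ClosureOperator (Theory L Sg)

/-- `T ⊢ T'`: the theory `T'` is derivable from `T`. -/
def Logic.Derives {L : FOLanguage.{l}} (ℒ : Logic.{l, s} L) {Sg : Signature.{s}}
    (T T' : Theory L Sg) : Prop :=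
  T' ≤ ℒ.cl Sg T

/-! ### Prop-categories -/

section Fibres

variable {C : Type u} [Category.{v} C]

/-- The poset `P(c)`. -/
abbrev Fib (P : Cᵒᵖ ⥤ PartOrd.{w}) (c : C) : Type w := P.obj (op c)

/-- The monotone map `P(f) : P(d) → P(c)` for `f : c ⟶ d`. -/
abbrev pull (P : Cᵒᵖ ⥤ PartOrd.{w}) {c d : C} (f : c ⟶ d) : Fib P d →o Fib P c :=
  (P.map f.op).hom

theorem pull_comp (P : Cᵒᵖ ⥤ PartOrd.{w}) {c d e : C} (f : c ⟶ d) (g : d ⟶ e) (x : Fib P e) :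
    pull P (f ≫ g) x = pull P f (pull P g x) := by
  change (P.map (f ≫ g).op).hom x = _
  rw [op_comp, P.map_comp]
  rfl

end Fibres

/-- The structure on a category `C` with designated finite products and a contravariant functor
`P : C → Pos` which makes `(C, P)` an object of `FA`. Here `c ⊗ d` is the designated product of
objects and `𝟙_ C` the designated terminal object. -/
structure FAStructure (L : FOLanguage.{l}) {C : Type u} [Category.{v} C]
    [CartesianMonoidalCategory C] (P : Cᵒᵖ ⥤ PartOrd.{w}) where
  /-- Each `P(c)` is an algebra for the propositional connectives. -/
  conn : ∀ (c : C) {n : ℕ}, L.conn n → (Fin n → Fib P c) → Fib P c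
  pull_conn : ∀ {c d : C} (f : c ⟶ d) {n : ℕ} (k : L.conn n) (x : Fin n → Fib P d),
    pull P f (conn d k x) = conn c k (fun i => pull P f (x i))
  /-- The designated element `Eq_c ∈ P(c × c)`. -/
  eqP : ∀ c : C, Fib P (c ⊗ c)
  /-- The quantifier maps `Ω_{b,c} : P(b × c) → P(b)`, natural in `b`. -/
  quant : L.quant → ∀ b c : C, Fib P (b ⊗ c) → Fib P b
  pull_quant : ∀ (Ω : L.quant) {b b' : C} (f : b ⟶ b') (c : C) (x : Fib P (b' ⊗ c)),
    pull P f (quant Ω b' c x) = quant Ω b c (pull P (f ▷ c) x)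
  /-- `(P(c), ⊗, e)` is a monoid. -/
  tensor_assoc : ∀ (c : C) (x y z : Fib P c),
    conn c L.tensor ![conn c L.tensor ![x, y], z] = conn c L.tensor ![x, conn c L.tensor ![y, z]]
  unit_tensor : ∀ (c : C) (x : Fib P c), conn c L.tensor ![conn c L.unit ![], x] = x
  tensor_unit : ∀ (c : C) (x : Fib P c), conn c L.tensor ![x, conn c L.unit ![]] = x
  quant_one : ∀ (Ω : L.quant) (b : C) (x : Fib P b),
    quant Ω b (𝟙_ C) (pull P (fst b (𝟙_ C)) x) = x
  quant_prod : ∀ (Ω : L.quant) (b c d : C) (x : Fib P ((b ⊗ c) ⊗ d)),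
    quant Ω b (c ⊗ d) (pull P (α_ b c d).inv x) = quant Ω b c (quant Ω (b ⊗ c) d x)
  eqP_one : eqP (𝟙_ C) = conn (𝟙_ C ⊗ 𝟙_ C) L.unit ![]
  eqP_prod : ∀ c₁ c₂ : C,
    eqP (c₁ ⊗ c₂) = conn ((c₁ ⊗ c₂) ⊗ (c₁ ⊗ c₂)) L.tensor
      ![pull P (lift (fst (c₁ ⊗ c₂) (c₁ ⊗ c₂) ≫ fst c₁ c₂)
            (snd (c₁ ⊗ c₂) (c₁ ⊗ c₂) ≫ fst c₁ c₂)) (eqP c₁),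
        pull P (lift (fst (c₁ ⊗ c₂) (c₁ ⊗ c₂) ≫ snd c₁ c₂)
            (snd (c₁ ⊗ c₂) (c₁ ⊗ c₂) ≫ snd c₁ c₂)) (eqP c₂)]

/-- The objects of `FA`. -/
structure FA (L : FOLanguage.{l}) where
  base : Type u
  [category : Category.{v} base]
  [products : CartesianMonoidalCategory base]
  fib : baseᵒᵖ ⥤ PartOrd.{w}
  str : FAStructure L fib

attribute [instance] FA.category FA.products

namespace FA

variable {L : FOLanguage.{l}}

/-- The morphisms of `FA`. The change-in-product isomorphism
`F(b × c) → F b × F c` is `prodComparison F b c`. -/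
@[ext]
structure Hom (X Y : FA.{l, u, v, w} L) where
  o : X.base ⥤ Y.base
  p : X.fib ⟶ o.op ⋙ Y.fib
  [preserves : Limits.PreservesFiniteProducts o]
  map_conn : ∀ (c : X.base) {n : ℕ} (k : L.conn n) (x : Fin n → Fib X.fib c),
    (p.app (op c)).hom (X.str.conn c k x) =
      Y.str.conn (o.obj c) k (fun i => (p.app (op c)).hom (x i))
  map_quant : ∀ (Ω : L.quant) (b c : X.base) (x : Fib X.fib (b ⊗ c)),
    (p.app (op b)).hom (X.str.quant Ω b c x) =
      Y.str.quant Ω (o.obj b) (o.obj c)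
        (pull Y.fib (inv (prodComparison o b c)) ((p.app (op (b ⊗ c))).hom x))
  map_eqP : ∀ c : X.base,
    (p.app (op (c ⊗ c))).hom (X.str.eqP c) =
      pull Y.fib (prodComparison o c c) (Y.str.eqP (o.obj c))

attribute [instance] Hom.preserves

/-- The component `F^p_c : P(c) → Q(F c)` of a morphism `F : (C, P) → (D, Q)`. -/
abbrev Hom.fibre {X Y : FA.{l, u, v, w} L} (F : Hom X Y) (c : X.base) :
    Fib X.fib c →o Fib Y.fib (F.o.obj c) :=
  (F.p.app (op c)).hom

theorem Hom.fibre_pull {X Y : FA.{l, u, v, w} L} (F : Hom X Y) {c d : X.base} (f : c ⟶ d)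
    (x : Fib X.fib d) : F.fibre c (pull X.fib f x) = pull Y.fib (F.o.map f) (F.fibre d x) :=
  congrArg (fun k => k.hom x) (F.p.naturality f.op)

/-- The identity morphism of `(C, P)`. -/
def Hom.id (X : FA.{l, u, v, w} L) : Hom X X where
  o := 𝟭 X.base
  p := 𝟙 X.fib
  map_conn _ _ _ _ := rfl
  map_quant Ω b c x := by
    have h : inv (prodComparison (𝟭 X.base) b c) = 𝟙 (b ⊗ c) := by
      simp
    rw [h]
    change _ = X.str.quant Ω b c ((X.fib.map (𝟙 _)).hom x)
    rw [X.fib.map_id]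
    rfl
  map_eqP c := by
    rw [prodComparison_id]
    change _ = (X.fib.map (𝟙 _)).hom _
    rw [X.fib.map_id]
    rfl

/-- Composition: `(K ∘ F)^o = K^o ∘ F^o` and `(K ∘ F)^p_c = K^p_{F c} ∘ F^p_c`. -/
def Hom.comp {X Y Z : FA.{l, u, v, w} L} (F : Hom X Y) (K : Hom Y Z) : Hom X Z where
  o := F.o ⋙ K.o
  p := F.p ≫ Functor.whiskerLeft F.o.op K.p
  preserves := Limits.comp_preservesFiniteProducts F.o K.o
  map_conn c n k x := by
    change K.fibre _ (F.fibre _ _) = _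
    rw [F.map_conn, K.map_conn]
    rfl
  map_quant Ω b c x := by
    change K.fibre _ (F.fibre _ _) = _
    rw [F.map_quant, K.map_quant]
    rw [K.fibre_pull, ← pull_comp]
    have h : inv (prodComparison (F.o ⋙ K.o) b c) =
        inv (prodComparison K.o (F.o.obj b) (F.o.obj c)) ≫ K.o.map (inv (prodComparison F.o b c)) := by
      simp [prodComparison_comp]
    rw [h]
    rfl
  map_eqP c := by
    change K.fibre _ (F.fibre _ _) = _
    rw [F.map_eqP]
    rw [K.fibre_pull, K.map_eqP, ← pull_comp, prodComparison_comp]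
    rfl

instance : Category (FA.{l, u, v, w} L) where
  Hom := Hom
  id := Hom.id
  comp := Hom.comp

end FA

/-! ### Structures in prop-categories and satisfaction -/

section Products

variable {C : Type u} [Category.{v} C] [CartesianMonoidalCategory C] {S : Type s}

/-- The product `c₁ × ⋯ × cₙ` of the objects assigned to the sorts of a context: the terminal
object for `n = 0`, `c₁` itself for `n = 1`, and `(c₁ × ⋯ × cₙ₋₁) × cₙ` for `n ≥ 2`. -/
def ctxObj (a : S → C) : Ctx S → C
  | .nil => 𝟙_ C
  | .snoc .nil σ => a σ
  | .snoc (.snoc Γ σ) τ => ctxObj a (.snoc Γ σ) ⊗ a τ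

/-- The projections `c₁ × ⋯ × cₙ → cᵢ`. -/
def ctxProj (a : S → C) : ∀ {Γ : Ctx S} {σ : S}, Var Γ σ → (ctxObj a Γ ⟶ a σ)
  | .snoc .nil σ, _, .last => 𝟙 (a σ)
  | .snoc (.snoc Γ σ) τ, _, .last => snd (ctxObj a (.snoc Γ σ)) (a τ)
  | .snoc (.snoc Γ σ) τ, _, .weaken x => fst (ctxObj a (.snoc Γ σ)) (a τ) ≫ ctxProj a x

/-- The morphism `⟨f₁, …, fₙ⟩ : b → c₁ × ⋯ × cₙ`. -/
def ctxLift (a : S → C) {b : C} : ∀ {Γ : Ctx S}, (∀ σ : S, Var Γ σ → (b ⟶ a σ)) → (b ⟶ ctxObj a Γ)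
  | .nil, _ => toUnit b
  | .snoc .nil σ, f => f σ .last
  | .snoc (.snoc Γ σ) τ, f =>
      lift (ctxLift a (Γ := .snoc Γ σ) (fun ρ x => f ρ x.weaken)) (f τ .last)

/-- The change-in-product isomorphism `(c₁ × ⋯ × cₙ) × c → c₁ × ⋯ × cₙ × c`; it is the identity
for `n ≥ 1` and the projection `1 × c → c` for `n = 0`. -/
def ctxSnoc (a : S → C) : ∀ (Γ : Ctx S) (σ : S), ctxObj a Γ ⊗ a σ ⟶ ctxObj a (Γ.snoc σ)
  | .nil, σ => snd (𝟙_ C) (a σ)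
  | .snoc Γ τ, σ => 𝟙 (ctxObj a (.snoc Γ τ) ⊗ a σ)

end Products

section Semantics

variable {L : FOLanguage.{l}}

/-- An `Sg`-structure in a prop-category. -/
structure Struct (Sg : Signature.{s}) (X : FA.{l, u, v, w} L) where
  srt : Sg.Srt → X.base
  fn : ∀ f : Sg.Fn, ctxObj srt (Sg.fnDom f) ⟶ srt (Sg.fnCod f)
  rel : ∀ R : Sg.Rel, Fib X.fib (ctxObj srt (Sg.relDom R))

variable {Sg : Signature.{s}} {X : FA.{l, u, v, w} L}

/-- The interpretation of terms in context. -/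
def Struct.term (S : Struct Sg X) {Γ : Ctx Sg.Srt} :
    ∀ {σ : Sg.Srt}, Term Sg Γ σ → (ctxObj S.srt Γ ⟶ S.srt σ)
  | _, .var x => ctxProj S.srt x
  | _, .app f M => ctxLift S.srt (fun σ x => S.term (M σ x)) ≫ S.fn f

/-- The interpretation of formulas in context. -/
def Struct.formula (S : Struct Sg X) :
    ∀ {Γ : Ctx Sg.Srt}, Formula L Sg Γ → Fib X.fib (ctxObj S.srt Γ)
  | _, .rel R M => pull X.fib (ctxLift S.srt (fun σ x => S.term (M σ x))) (S.rel R)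
  | _, .eq (σ := σ) M N => pull X.fib (lift (S.term M) (S.term N)) (X.str.eqP (S.srt σ))
  | Γ, .conn k φ => X.str.conn (ctxObj S.srt Γ) k (fun i => S.formula (φ i))
  | Γ, .quant (σ := σ) Ω φ =>
      X.str.quant Ω (ctxObj S.srt Γ) (S.srt σ) (pull X.fib (ctxSnoc S.srt Γ σ) (S.formula φ))

/-- The monoid product `x₁ ⊗ ⋯ ⊗ xₙ` in `P(c)`, which is `e_c` for `n = 0`. -/
def FA.tensorList (X : FA.{l, u, v, w} L) (c : X.base) (x : List (Fib X.fib c)) : Fib X.fib c :=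
  x.foldr (fun y z => X.str.conn c L.tensor ![y, z]) (X.str.conn c L.unit ![])

/-- The structure `S` satisfies an assertion. -/
def Struct.Satisfies (S : Struct Sg X) : Assertion L Sg → Prop
  | .eqn _ _ M N => S.term M = S.term N
  | .seq Γ φ ψ => X.tensorList (ctxObj S.srt Γ) (φ.map S.formula) ≤ S.formula ψ

/-- The structure `S` is a `T`-model. -/
def Struct.IsModel (S : Struct Sg X) (T : Theory L Sg) : Prop :=
  ∀ A ∈ T, S.Satisfies A

end Semantics

/-- `T ⊨ T'` in the prop-category `X`: every `T`-model in `X` is a `T'`-model. -/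
def FA.Entails {L : FOLanguage.{l}} (X : FA.{l, u, v, w} L) {Sg : Signature.{s}}
    (T T' : Theory L Sg) : Prop :=
  ∀ S : Struct Sg X, S.IsModel T → S.IsModel T'

/-! ### The category `FA_ℒ`, the classes `ℰ` and `ℳ`, and factorization systems -/

/-- An orthogonal factorization system `(E, M)` on a category: both classes contain all
isomorphisms and are closed under composition, every morphism is a morphism of `E` followed by one
of `M`, and such factorizations are uniquely functorial. (Taking `e'` and `m` to be identities in
`exists_unique`, every commutative square from `e ∈ E` to `m' ∈ M` has a unique diagonal.) -/
structure IsOrthogonalFactorizationSystem {C : Type u} [Category.{v} C]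
    (E M : MorphismProperty C) : Prop where
  iso_left : MorphismProperty.isomorphisms C ≤ E
  iso_right : MorphismProperty.isomorphisms C ≤ M
  comp_left : E.IsStableUnderComposition
  comp_right : M.IsStableUnderComposition
  factorization : ∀ {X Y : C} (f : X ⟶ Y),
    ∃ (Z : C) (e : X ⟶ Z) (m : Z ⟶ Y), E e ∧ M m ∧ e ≫ m = f
  exists_unique : ∀ {X Z Y X' Z' Y' : C} (e : X ⟶ Z) (m : Z ⟶ Y) (e' : X' ⟶ Z') (m' : Z' ⟶ Y')
    (u : X ⟶ X') (v : Y ⟶ Y'), E e → M m → E e' → M m' → (e ≫ m) ≫ v = u ≫ (e' ≫ m') →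
      ∃! k : Z ⟶ Z', e ≫ k = u ≫ e' ∧ k ≫ m' = m ≫ v

variable {L : FOLanguage.{l}}

/-- The prop-categories in which the logic `ℒ` is sound. -/
def Logic.IsSound (ℒ : Logic.{l, s} L) : ObjectProperty (FA.{l, u, v, w} L) :=
  fun X => ∀ (Sg : Signature.{s}) (T T' : Theory L Sg), ℒ.Derives T T' → X.Entails T T'

/-- `FA_ℒ`, the full subcategory of `FA` on the prop-categories in which `ℒ` is sound. -/
abbrev FASub (ℒ : Logic.{l, s} L) :=
  (ℒ.IsSound : ObjectProperty (FA.{l, u, v, w} L)).FullSubcategory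

/-- The class `ℰ`: bijective on objects, full, and surjective on every fibre. -/
def classE (ℒ : Logic.{l, s} L) : MorphismProperty (FASub.{l, s, u, v, w} ℒ) :=
  fun X _ F => Function.Bijective F.hom.o.obj ∧ F.hom.o.Full ∧
    ∀ c : X.obj.base, Function.Surjective (F.hom.fibre c)

/-- The class `ℳ` of subprop-morphisms: faithful, and an order embedding on every fibre. -/
def classM (ℒ : Logic.{l, s} L) : MorphismProperty (FASub.{l, s, u, v, w} ℒ) :=
  fun X _ F => F.hom.o.Faithful ∧
    ∀ (c : X.obj.base) (x y : Fib X.obj.fib c), F.hom.fibre c x ≤ F.hom.fibre c y ↔ x ≤ y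

end PropLogic

namespace PropLogic

open CategoryTheory MonoidalCategory CartesianMonoidalCategory Opposite

/-! ### Morphisms of prop-categories -/

/-! The factorization is the image factorization. For `F : (C, P) → (D, Q)`, keep the objects of
`C`, let the arrows `a → b` be the arrows `F a → F b` of the form `F g`, and let the fibre over `c`
be the image of `P(c)` in `Q(F c)`, with the order of `Q`. Because `F` respects the structure, the
products of `C` remain products and the operations of `Q` restrict; the axioms follow since every
arrow and every fibre element of the image lifts to `(C, P)`.

The image must again be sound for the logic. Any morphism carries structures forward and commutes
with the interpretation of terms and formulas up to the isomorphisms `F(c₁ × ⋯ × cₙ) → F c₁ × ⋯ × F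
cₙ` (`Struct.map_formula`). A subprop-morphism therefore preserves and reflects satisfaction, so
soundness passes from its codomain to its domain (`Logic.IsSound.of_isSub`).

Unique functoriality reduces to filling a square from `E` in the first class to `M` in the second
(`Hom.existsUnique_lift`). Bijectivity of `E` on objects fixes the diagonal on objects; fullness and
surjectivity of `E` give lifts of arrows and fibre elements through `M`, and faithfulness and order
reflection of `M` make these lifts unique, functorial and compatible with all the structure. -/

theorem pull_id {C : Type u} [Category.{v} C] (P : Cᵒᵖ ⥤ PartOrd.{w}) (c : C) (x : Fib P c) :
    pull P (𝟙 c) x = x := by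
  change (P.map (𝟙 c).op).hom x = x
  rw [op_id, P.map_id]
  rfl

theorem preservesFiniteProducts_of_isIso_comparison {C D : Type*} [Category C] [Category D]
    [CartesianMonoidalCategory C] [CartesianMonoidalCategory D] (F : C ⥤ D)
    (h₀ : IsIso (terminalComparison F)) (h₂ : ∀ a b, IsIso (prodComparison F a b)) :
    Limits.PreservesFiniteProducts F := by
  have := preservesLimit_empty_of_isIso_terminalComparison F
  have := preservesLimitsOfShape_discrete_walkingPair_of_isIso_prodComparison F
  have := Limits.preservesLimitsOfShape_pempty_of_preservesTerminal F
  exact .of_preserves_binary_and_terminal F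

namespace FA

variable {L : FOLanguage.{l}} {X Y Z : FA.{l, u, v, w} L}

/-- A morphism which is bijective on objects, full, and surjective on every fibre. -/
structure Hom.IsCover (F : Hom X Y) : Prop where
  bijective : Function.Bijective F.o.obj
  full : F.o.Full
  surjective : ∀ c : X.base, Function.Surjective (F.fibre c)

/-- A morphism which is faithful and an order embedding on every fibre. -/
structure Hom.IsSub (F : Hom X Y) : Prop where
  faithful : F.o.Faithful
  le_iff : ∀ (c : X.base) (x y : Fib X.fib c), F.fibre c x ≤ F.fibre c y ↔ x ≤ y

theorem Hom.IsSub.injective {F : Hom X Y} (hF : F.IsSub) (c : X.base) :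
    Function.Injective (F.fibre c) := fun x y h =>
  le_antisymm ((hF.le_iff c x y).1 h.le) ((hF.le_iff c y x).1 h.ge)

theorem Hom.IsCover.comp {F : Hom X Y} {G : Hom Y Z} (hF : F.IsCover) (hG : G.IsCover) :
    (F.comp G).IsCover where
  bijective := hG.bijective.comp hF.bijective
  full := by
    have := hF.full
    have := hG.full
    exact inferInstanceAs (F.o ⋙ G.o).Full
  surjective c := (hG.surjective _).comp (hF.surjective c)

theorem Hom.IsSub.comp {F : Hom X Y} {G : Hom Y Z} (hF : F.IsSub) (hG : G.IsSub) :
    (F.comp G).IsSub where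
  faithful := by
    have := hF.faithful
    have := hG.faithful
    exact inferInstanceAs (F.o ⋙ G.o).Faithful
  le_iff c x y := (hG.le_iff _ _ _).trans (hF.le_iff c x y)

/-- The two values lie in fibres over objects that are equal only propositionally, so they are
compared by pulling back along `eqToHom`. -/
theorem Hom.fibre_congr {F G : Hom X Y} (h : F = G) (c : X.base) (x : Fib X.fib c) :
    F.fibre c x = pull Y.fib (eqToHom (by rw [h])) (G.fibre c x) := by
  subst h
  exact (pull_id _ _ _).symm

theorem Hom.isCover_isSub_of_inverse {F : Hom X Y} {G : Hom Y X} (hFG : F.comp G = Hom.id X)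
    (hGF : G.comp F = Hom.id Y) : F.IsCover ∧ F.IsSub := by
  have h₁ : F.o ⋙ G.o = 𝟭 X.base := congrArg Hom.o hFG
  have h₂ : G.o ⋙ F.o = 𝟭 Y.base := congrArg Hom.o hGF
  have hE : F.o.IsEquivalence :=
    (CategoryTheory.Equivalence.mk F.o G.o (eqToIso h₁.symm) (eqToIso h₂)).isEquivalence_functor
  have obj₁ (c : X.base) : G.o.obj (F.o.obj c) = c := Functor.congr_obj h₁ c
  have obj₂ (c : Y.base) : F.o.obj (G.o.obj c) = c := Functor.congr_obj h₂ c
  -- The inverse image of `y` under `F` at `c` is `G y`, which lies over `G (F c)` and is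
  -- transported to `c`.
  refine ⟨⟨⟨Function.LeftInverse.injective obj₁, Function.RightInverse.surjective obj₂⟩,
    inferInstance, fun c y => ⟨pull X.fib (eqToHom (obj₁ c).symm) (G.fibre _ y), ?_⟩⟩,
    ⟨inferInstance, fun c x y => ⟨fun h => ?_, fun h => (F.fibre c).monotone h⟩⟩⟩
  · rw [F.fibre_pull]
    have : F.fibre _ (G.fibre _ y) = pull Y.fib (eqToHom (obj₂ _)) y := Hom.fibre_congr hGF _ y
    rw [this, ← pull_comp, eqToHom_map, eqToHom_trans, eqToHom_refl, pull_id]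
  · have key (x : Fib X.fib c) :
        pull X.fib (eqToHom (obj₁ c).symm) (G.fibre _ (F.fibre c x)) = x := by
      have : G.fibre _ (F.fibre _ x) = pull X.fib (eqToHom (obj₁ _)) x :=
        Hom.fibre_congr hFG _ x
      rw [this, ← pull_comp, eqToHom_trans, eqToHom_refl, pull_id]
    rw [← key x, ← key y]
    exact (pull X.fib _).monotone ((G.fibre _).monotone h)

/-! ### Diagonal fill-ins -/

theorem functor_eq_of_comp_faithful_eq {A B C : Type*} [Category A] [Category B] [Category C]
    {F G : A ⥤ B} (H : B ⥤ C) [H.Faithful] (hobj : F.obj = G.obj) (h : F ⋙ H = G ⋙ H) : F = G :=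
  CategoryTheory.Functor.ext (fun a => congrFun hobj a) fun a b f => H.map_injective <| by
    have := Functor.congr_hom h f
    simpa [eqToHom_map] using this

/-- A faithful functor may identify objects, so agreement on objects has to be supplied; arrows and
fibre elements are then separated by `K`. -/
theorem Hom.IsSub.cancel {K : Hom Y Z} (hK : K.IsSub) {F G : Hom X Y}
    (hobj : F.o.obj = G.o.obj) (h : F.comp K = G.comp K) : F = G := by
  have := hK.faithful
  have ho : F.o = G.o := functor_eq_of_comp_faithful_eq K.o hobj (congrArg Hom.o h)
  obtain ⟨Fo, Fp, _, _, _⟩ := F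
  obtain ⟨Go, Gp, _, _, _⟩ := G
  obtain rfl : Fo = Go := ho
  have hp : Fp = Gp := by
    have h' := (Hom.mk.inj h).2
    ext c x
    have h'' := congrArg (fun k => (k.app c).hom x) (eq_of_heq h')
    exact hK.injective _ h''
  subst hp
  rfl

/-- On objects the lift is `f` after the inverse of `e`. An arrow of `B` lifts because it comes from
`A` by fullness; since `m` is faithful the lift is unique, so an arbitrary choice of lifts is
functorial. -/
theorem exists_functor_lift {A B C D : Type*} [Category A] [Category B] [Category C] [Category D]
    (e : A ⥤ B) (he : Function.Bijective e.obj) [e.Full] (m : C ⥤ D) [m.Faithful]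
    (f : A ⥤ C) (g : B ⥤ D) (h : e ⋙ g = f ⋙ m) :
    ∃ k : B ⥤ C, k ⋙ m = g ∧ e ⋙ k = f := by
  obtain ⟨σ, hσ⟩ : ∃ σ : B → C, ∀ a, σ (e.obj a) = f.obj a :=
    ⟨fun b => f.obj ((Equiv.ofBijective _ he).symm b), fun a =>
      congrArg f.obj ((Equiv.ofBijective _ he).symm_apply_apply a)⟩
  have hobj (b : B) : m.obj (σ b) = g.obj b := by
    obtain ⟨a, rfl⟩ := he.2 b
    rw [hσ]
    exact (Functor.congr_obj h a).symm
  have hmap {b b' : B} (t : b ⟶ b') :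
      ∃ r : σ b ⟶ σ b', m.map r = eqToHom (hobj b) ≫ g.map t ≫ eqToHom (hobj b').symm := by
    obtain ⟨a, rfl⟩ := he.2 b
    obtain ⟨a', rfl⟩ := he.2 b'
    obtain ⟨t, rfl⟩ := e.map_surjective t
    refine ⟨eqToHom (hσ a) ≫ f.map t ≫ eqToHom (hσ a').symm, ?_⟩
    have := Functor.congr_hom h t
    simp only [Functor.comp_map] at this
    simp [this, eqToHom_map]
  choose r hr using @hmap
  let k : B ⥤ C :=
    { obj := σ
      map := r
      map_id := fun b => m.map_injective (by simp [hr])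
      map_comp := fun t t' => m.map_injective (by simp [hr]) }
  have hk : k ⋙ m = g := CategoryTheory.Functor.ext hobj fun b b' t => hr t
  refine ⟨k, hk, functor_eq_of_comp_faithful_eq m (funext hσ) ?_⟩
  rw [Functor.assoc, hk, h]

/-- Two out of three: the comparison for `e ⋙ k` is `k` of the comparison for `e` followed by the
comparison for `k`, and every pair of objects of `B` comes from `A`. -/
theorem preservesFiniteProducts_of_comp {A B C : Type*} [Category A] [Category B] [Category C]
    [CartesianMonoidalCategory A] [CartesianMonoidalCategory B] [CartesianMonoidalCategory C]
    (e : A ⥤ B) (k : B ⥤ C) (he : Function.Surjective e.obj)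
    [Limits.PreservesFiniteProducts e] [Limits.PreservesFiniteProducts (e ⋙ k)] :
    Limits.PreservesFiniteProducts k := by
  refine preservesFiniteProducts_of_isIso_comparison k ?_ fun b b' => ?_
  · have h : k.map (terminalComparison e) ≫ terminalComparison k = terminalComparison (e ⋙ k) :=
      toUnit_unique _ _
    have : IsIso (k.map (terminalComparison e) ≫ terminalComparison k) := by
      rw [h]
      infer_instance
    exact IsIso.of_isIso_comp_left (k.map (terminalComparison e)) _
  · obtain ⟨a, rfl⟩ := he b
    obtain ⟨a', rfl⟩ := he b'
    have : IsIso (k.map (prodComparison e a a') ≫ prodComparison k (e.obj a) (e.obj a')) := by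
      rw [← prodComparison_comp]
      infer_instance
    exact IsIso.of_isIso_comp_left (k.map (prodComparison e a a')) _

/-- A fibre element of `Y` lifts along `E`, so its image under `G` lies in the image of `M`. Each
condition on the diagonal is checked after applying `M`, where it becomes the one for `G`. -/
theorem Hom.exists_lift {X' Y' : FA.{l, u, v, w} L} {E : Hom X Y} (hE : E.IsCover)
    {M : Hom X' Y'} (hM : M.IsSub) (F : Hom X X') (G : Hom Y Y') (h : E.comp G = F.comp M) :
    ∃ K : Hom Y X', E.comp K = F ∧ K.comp M = G := by
  have := hE.full
  have := hM.faithful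
  obtain ⟨k, hk₁, hk₂⟩ := exists_functor_lift E.o hE.bijective M.o F.o G.o (congrArg Hom.o h)
  obtain ⟨Fo, Fp, Fconn, Fquant, Feq⟩ := F
  obtain ⟨Go, Gp, Gconn, Gquant, Geq⟩ := G
  -- The base functors of `F` and `G` become literally `E.o ⋙ k` and `k ⋙ M.o`, so no transport
  -- along object equalities enters the fibres.
  subst hk₁ hk₂
  have hp (c : X.base) (x : Fib X.fib c) : (Gp.app (op (E.o.obj c))).hom (E.fibre c x) =
      M.fibre _ ((Fp.app (op c)).hom x) :=
    congrArg (fun t => (t.app (op c)).hom x) (eq_of_heq (Hom.mk.inj h).2)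
  have hex (c : Y.base) (y : Fib Y.fib c) :
      ∃ z : Fib X'.fib (k.obj c), M.fibre _ z = (Gp.app (op c)).hom y := by
    obtain ⟨a, rfl⟩ := hE.bijective.2 c
    obtain ⟨x, rfl⟩ := hE.surjective a y
    exact ⟨_, (hp a x).symm⟩
  choose q hq using hex
  have hkp : Limits.PreservesFiniteProducts k :=
    preservesFiniteProducts_of_comp E.o k hE.bijective.2
  have hGpull {c d : Y.base} (f : c ⟶ d) (y : Fib Y.fib d) :
      (Gp.app (op c)).hom (pull Y.fib f y) =
        pull Y'.fib (M.o.map (k.map f)) ((Gp.app (op d)).hom y) :=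
    congrArg (fun t => t.hom y) (Gp.naturality f.op)
  let K : Hom Y X' :=
    { o := k
      p :=
        -- Monotonicity needs `M` to reflect the order; injectivity would not suffice.
        { app := fun c => PartOrd.ofHom ⟨q c.unop, fun x y hxy =>
            (hM.le_iff _ _ _).1 (by rw [hq, hq]; exact (Gp.app c).hom.monotone hxy)⟩
          naturality := fun d c f => by
            ext y
            apply hM.injective
            change M.fibre _ (q c.unop (pull Y.fib f.unop y)) =
              M.fibre _ (pull X'.fib (k.map f.unop) (q d.unop y))
            rw [hq, M.fibre_pull, hq]
            exact hGpull f.unop y }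
      preserves := hkp
      map_conn := fun c n j x => hM.injective _ <| by
        change M.fibre _ (q c _) = M.fibre _ (X'.str.conn (k.obj c) j fun i => q c (x i))
        rw [hq, M.map_conn, Gconn]
        exact congrArg _ (funext fun i => (hq c (x i)).symm)
      map_quant := fun Ω b c x => hM.injective _ <| by
        change M.fibre _ (q b _) =
          M.fibre _ (X'.str.quant Ω (k.obj b) (k.obj c) (pull X'.fib _ (q (b ⊗ c) x)))
        rw [hq, Gquant, M.map_quant]
        change _ = Y'.str.quant _ _ _ (pull _ _ (M.fibre _ _))
        rw [M.fibre_pull, hq, ← pull_comp]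
        have h : inv (prodComparison (k ⋙ M.o) b c) =
            inv (prodComparison M.o (k.obj b) (k.obj c)) ≫
              M.o.map (inv (prodComparison k b c)) := by
          simp [prodComparison_comp]
        rw [h]
        rfl
      map_eqP := fun c => hM.injective _ <| by
        change M.fibre _ (q (c ⊗ c) _) = M.fibre _ _
        rw [hq, Geq, M.fibre_pull, M.map_eqP, ← pull_comp, prodComparison_comp]
        rfl }
  have hKM : K.comp M = ⟨k ⋙ M.o, Gp, Gconn, Gquant, Geq⟩ := by
    refine Hom.ext rfl (heq_of_eq ?_)
    ext c y
    exact hq c.unop y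
  refine ⟨K, ?_, hKM⟩
  refine hM.cancel rfl ?_
  rw [← h, ← hKM]
  rfl

theorem Hom.existsUnique_lift {X' Y' : FA.{l, u, v, w} L} {E : Hom X Y} (hE : E.IsCover)
    {M : Hom X' Y'} (hM : M.IsSub) (F : Hom X X') (G : Hom Y Y') (h : E.comp G = F.comp M) :
    ∃! K : Hom Y X', E.comp K = F ∧ K.comp M = G := by
  obtain ⟨K, hK⟩ := Hom.exists_lift hE hM F G h
  -- Two diagonals agree on objects because `E` is surjective on objects.
  refine ⟨K, hK, fun K' hK' => hM.cancel (funext fun b => ?_) (hK'.2.trans hK.2.symm)⟩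
  obtain ⟨a, rfl⟩ := hE.bijective.2 b
  exact Functor.congr_obj (congrArg Hom.o (hK'.1.trans hK.1.symm)) a

end FA

/-! ### Transport of structures along morphisms -/

section Products

variable {C D : Type*} [Category C] [CartesianMonoidalCategory C] [Category D]
  [CartesianMonoidalCategory D] {S : Type s}

theorem ctxLift_ctxProj (a : S → C) {b : C} : ∀ {Γ : Ctx S} {σ : S}
    (f : ∀ σ : S, Var Γ σ → (b ⟶ a σ)) (x : Var Γ σ), ctxLift a f ≫ ctxProj a x = f σ x
  | .snoc .nil _, _, _, .last => Category.comp_id _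
  | .snoc (.snoc _ _) _, _, _, .last => lift_snd _ _
  | .snoc (.snoc _ _) _, _, f, .weaken x =>
      (lift_fst_assoc _ _ _).trans (ctxLift_ctxProj a (fun ρ x => f ρ x.weaken) x)

theorem comp_ctxLift (a : S → C) {b b' : C} (g : b' ⟶ b) : ∀ {Γ : Ctx S}
    (f : ∀ σ : S, Var Γ σ → (b ⟶ a σ)), g ≫ ctxLift a f = ctxLift a (fun σ x => g ≫ f σ x)
  | .nil, _ => toUnit_unique _ _
  | .snoc .nil _, _ => rfl
  | .snoc (.snoc Γ σ) _, f =>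
      (comp_lift _ _ _).trans (congrArg (lift · _)
        (comp_ctxLift a g (Γ := .snoc Γ σ) fun ρ x => f ρ x.weaken))

/-- The change-in-product morphism `F(c₁ × ⋯ × cₙ) → F c₁ × ⋯ × F cₙ`. -/
def ctxComparison (F : C ⥤ D) (a : S → C) (Γ : Ctx S) :
    F.obj (ctxObj a Γ) ⟶ ctxObj (fun σ => F.obj (a σ)) Γ :=
  ctxLift (fun σ => F.obj (a σ)) fun _ x => F.map (ctxProj a x)

theorem ctxComparison_nil_snoc (F : C ⥤ D) (a : S → C) (σ : S) :
    ctxComparison F a (Ctx.nil.snoc σ) = 𝟙 (F.obj (a σ)) :=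
  F.map_id _

/-- This recursion reduces the n-ary comparison to binary ones. It starts at contexts of length one,
whose product is the object itself rather than `1 × c`. -/
theorem ctxComparison_snoc_snoc (F : C ⥤ D) (a : S → C) (Γ : Ctx S) (σ τ : S) :
    ctxComparison F a ((Γ.snoc σ).snoc τ) =
      prodComparison F (ctxObj a (Γ.snoc σ)) (a τ) ≫
        ctxComparison F a (Γ.snoc σ) ▷ F.obj (a τ) := by
  have h : F.map (fst (ctxObj a (Γ.snoc σ)) (a τ)) ≫ ctxComparison F a (Γ.snoc σ) =
      ctxLift (fun σ => F.obj (a σ)) fun _ x => F.map (fst _ _ ≫ ctxProj a x) := by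
    simp only [ctxComparison, comp_ctxLift, F.map_comp]
  change lift (ctxLift (fun σ => F.obj (a σ)) fun _ x => F.map (fst _ _ ≫ ctxProj a x))
    (F.map (snd (ctxObj a (Γ.snoc σ)) (a τ))) = _
  rw [← h]
  apply CartesianMonoidalCategory.hom_ext <;> simp

theorem map_ctxLift_comp_ctxComparison (F : C ⥤ D) (a : S → C) {b : C} {Γ : Ctx S}
    (f : ∀ σ : S, Var Γ σ → (b ⟶ a σ)) :
    F.map (ctxLift a f) ≫ ctxComparison F a Γ =
      ctxLift (fun σ => F.obj (a σ)) (fun σ x => F.map (f σ x)) := by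
  simp only [ctxComparison, comp_ctxLift, ← Functor.map_comp, ctxLift_ctxProj]

instance isIso_ctxComparison (F : C ⥤ D) [Limits.PreservesFiniteProducts F] (a : S → C) :
    ∀ Γ : Ctx S, IsIso (ctxComparison F a Γ)
  | .nil => inferInstanceAs (IsIso (terminalComparison F))
  | .snoc .nil σ => by
      rw [ctxComparison_nil_snoc]
      exact inferInstanceAs (IsIso (𝟙 (F.obj (a σ))))
  | .snoc (.snoc Γ σ) τ => by
      have := isIso_ctxComparison F a (.snoc Γ σ)
      rw [ctxComparison_snoc_snoc]
      exact inferInstanceAs (IsIso (prodComparison F (ctxObj a (Γ.snoc σ)) (a τ) ≫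
        ctxComparison F a (Γ.snoc σ) ▷ F.obj (a τ)))

/-- This is the coherence behind the quantifier clause of `Struct.map_formula`. The empty context is
separate because there `ctxSnoc` is a projection instead of an identity. -/
theorem map_ctxSnoc_comp_ctxComparison (F : C ⥤ D) (a : S → C) (Γ : Ctx S) (σ : S) :
    F.map (ctxSnoc a Γ σ) ≫ ctxComparison F a (Γ.snoc σ) =
      prodComparison F (ctxObj a Γ) (a σ) ≫ ctxComparison F a Γ ▷ F.obj (a σ) ≫
        ctxSnoc (fun σ => F.obj (a σ)) Γ σ := by
  cases Γ with
  | nil =>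
    rw [ctxComparison_nil_snoc]
    refine (Category.comp_id (F.map (snd (𝟙_ C) (a σ)))).trans ?_
    change _ = prodComparison F (𝟙_ C) (a σ) ≫ terminalComparison F ▷ F.obj (a σ) ≫ snd _ _
    rw [whiskerRight_snd, prodComparison_snd]
  | snoc Γ τ =>
    change F.map (𝟙 (ctxObj a (Γ.snoc τ) ⊗ a σ)) ≫ ctxComparison F a ((Γ.snoc τ).snoc σ) =
      prodComparison F (ctxObj a (Γ.snoc τ)) (a σ) ≫ ctxComparison F a (Γ.snoc τ) ▷ F.obj (a σ) ≫
        𝟙 (ctxObj (fun σ => F.obj (a σ)) (Γ.snoc τ) ⊗ F.obj (a σ))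
    rw [Category.comp_id, F.map_id, ctxComparison_snoc_snoc]
    exact Category.id_comp _

end Products

/-! ### Interpretation and satisfaction under a morphism -/

variable {L : FOLanguage.{l}} {Sg : Signature.{s}} {X Y : FA.{l, u, v, w} L}

/-- The image of a structure under a morphism of prop-categories. -/
noncomputable abbrev Struct.map (S : Struct Sg X) (F : FA.Hom X Y) : Struct Sg Y where
  srt σ := F.o.obj (S.srt σ)
  fn f := inv (ctxComparison F.o S.srt (Sg.fnDom f)) ≫ F.o.map (S.fn f)
  rel R := pull Y.fib (inv (ctxComparison F.o S.srt (Sg.relDom R))) (F.fibre _ (S.rel R))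

theorem Struct.map_term (S : Struct Sg X) (F : FA.Hom X Y) {Γ : Ctx Sg.Srt} {σ : Sg.Srt}
    (M : Term Sg Γ σ) :
    F.o.map (S.term M) = ctxComparison F.o S.srt Γ ≫ (S.map F).term M := by
  induction M with
  | var x =>
    exact (ctxLift_ctxProj (fun σ => F.o.obj (S.srt σ)) (fun _ x => F.o.map (ctxProj _ x)) x).symm
  | app f M ih =>
    have h := map_ctxLift_comp_ctxComparison F.o S.srt (fun σ x => S.term (M σ x))
    simp only [ih] at h
    rw [← comp_ctxLift, ← IsIso.eq_comp_inv, Category.assoc] at h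
    refine (F.o.map_comp _ _).trans ?_
    rw [h, Category.assoc, Category.assoc]
    rfl

theorem Struct.map_ctxLift_term (S : Struct Sg X) (F : FA.Hom X Y) {Γ Δ : Ctx Sg.Srt}
    (M : ∀ σ : Sg.Srt, Var Δ σ → Term Sg Γ σ) :
    F.o.map (ctxLift S.srt fun σ x => S.term (M σ x)) ≫ ctxComparison F.o S.srt Δ =
      ctxComparison F.o S.srt Γ ≫ ctxLift (S.map F).srt fun σ x => (S.map F).term (M σ x) := by
  rw [map_ctxLift_comp_ctxComparison, comp_ctxLift]
  simp only [Struct.map_term]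

/-- By induction on the formula. For relation symbols the inverse comparison in `Struct.map`
cancels; for connectives and quantifiers, compatibility of `F` is combined with stability under
pullback in `Y`, which moves the comparison past the operation. -/
theorem Struct.map_formula (S : Struct Sg X) (F : FA.Hom X Y) {Γ : Ctx Sg.Srt}
    (φ : Formula L Sg Γ) :
    F.fibre _ (S.formula φ) =
      pull Y.fib (ctxComparison F.o S.srt Γ) ((S.map F).formula φ) := by
  induction φ with
  | rel R M =>
    have h := S.map_ctxLift_term F M
    rw [← IsIso.eq_comp_inv, Category.assoc] at h
    refine (F.fibre_pull _ _).trans ?_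
    rw [h, pull_comp, pull_comp]
    rfl
  | @eq Γ σ M N =>
    have h : F.o.map (lift (S.term M) (S.term N)) ≫ prodComparison F.o (S.srt σ) (S.srt σ) =
        ctxComparison F.o S.srt Γ ≫ lift ((S.map F).term M) ((S.map F).term N) := by
      apply CartesianMonoidalCategory.hom_ext
      · simp [← Functor.map_comp, S.map_term F M]
      · simp [← Functor.map_comp, S.map_term F N]
    refine (F.fibre_pull _ _).trans ?_
    rw [F.map_eqP, ← pull_comp, h, pull_comp]
    rfl
  | conn k φ ih =>
    refine (F.map_conn _ _ _).trans (Eq.trans ?_ (Y.str.pull_conn _ _ _).symm)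
    exact congrArg _ (funext ih)
  | @quant Γ σ Ω φ ih =>
    refine (F.map_quant _ _ _ _).trans (Eq.trans ?_ (Y.str.pull_quant _ _ _ _).symm)
    refine congrArg (Y.str.quant Ω _ _) ?_
    change pull Y.fib _ (F.fibre _ (pull X.fib (ctxSnoc S.srt Γ σ) _)) = _
    rw [F.fibre_pull, ih, ← pull_comp, ← pull_comp, Category.assoc, map_ctxSnoc_comp_ctxComparison,
      IsIso.inv_hom_id_assoc, pull_comp]

theorem FA.Hom.map_tensorList (F : FA.Hom X Y) (c : X.base) (x : List (Fib X.fib c)) :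
    F.fibre c (X.tensorList c x) = Y.tensorList (F.o.obj c) (x.map (F.fibre c)) := by
  induction x with
  | nil =>
    refine (F.map_conn _ _ _).trans (congrArg _ (Subsingleton.elim _ _))
  | cons y x ih =>
    refine (F.map_conn _ _ _).trans (congrArg _ (funext fun i => ?_))
    refine Fin.cases rfl (fun i => ?_) i
    refine Fin.cases ih (fun i => i.elim0) i

theorem FA.pull_tensorList (X : FA.{l, u, v, w} L) {c d : X.base} (f : c ⟶ d)
    (x : List (Fib X.fib d)) :
    pull X.fib f (X.tensorList d x) = X.tensorList c (x.map (pull X.fib f)) := by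
  induction x with
  | nil =>
    refine (X.str.pull_conn _ _ _).trans (congrArg _ (Subsingleton.elim _ _))
  | cons y x ih =>
    refine (X.str.pull_conn _ _ _).trans (congrArg _ (funext fun i => ?_))
    refine Fin.cases rfl (fun i => ?_) i
    refine Fin.cases ih (fun i => i.elim0) i

theorem pull_le_pull_iff {C : Type u} [Category.{v} C] (P : Cᵒᵖ ⥤ PartOrd.{w}) {c d : C}
    (f : c ⟶ d) [IsIso f] (x y : Fib P d) : pull P f x ≤ pull P f y ↔ x ≤ y := by
  refine ⟨fun h => ?_, fun h => (pull P f).monotone h⟩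
  have := (pull P (inv f)).monotone h
  rwa [← pull_comp, ← pull_comp, IsIso.inv_hom_id, pull_id, pull_id] at this

/-- Up to the invertible comparison, the interpretations in `S.map F` are the images of those in
`S`; faithfulness settles equations and order embedding settles sequents. -/
theorem Struct.satisfies_map_iff (S : Struct Sg X) {F : FA.Hom X Y} (hF : F.IsSub)
    (A : Assertion L Sg) : (S.map F).Satisfies A ↔ S.Satisfies A := by
  cases A with
  | eqn Γ σ M N =>
    have := hF.faithful
    change (S.map F).term M = (S.map F).term N ↔ S.term M = S.term N
    rw [← cancel_epi (ctxComparison F.o S.srt Γ), ← S.map_term F, ← S.map_term F]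
    exact F.o.map_injective.eq_iff
  | seq Γ φ ψ =>
    change Y.tensorList _ (φ.map (S.map F).formula) ≤ (S.map F).formula ψ ↔
      X.tensorList _ (φ.map S.formula) ≤ S.formula ψ
    rw [← hF.le_iff, S.map_formula F, F.map_tensorList,
      ← pull_le_pull_iff Y.fib (ctxComparison F.o S.srt Γ), Y.pull_tensorList, List.map_map,
      List.map_map]
    have h : F.fibre _ ∘ S.formula =
        pull Y.fib (ctxComparison F.o S.srt Γ) ∘ (S.map F).formula :=
      funext fun χ => S.map_formula F χ
    rw [h]

/-- Push a model forward, use soundness of `Y`, and reflect the conclusion back. Nothing about the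
closure operator is needed. -/
theorem Logic.IsSound.of_isSub {ℒ : Logic.{l, s} L} {F : FA.Hom X Y} (hF : F.IsSub)
    (hY : ℒ.IsSound Y) : ℒ.IsSound X := fun Sg T T' h S hS A hA =>
  (S.satisfies_map_iff hF A).1 <| hY Sg T T' h (S.map F)
    (fun B hB => (S.satisfies_map_iff hF B).2 (hS B hB)) A hA

/-! ### The image of a morphism -/

namespace FA

variable {L : FOLanguage.{l}} {X Y : FA.{l, u, v, w} L}

/-- The base category of the image of `F : (C, P) → (D, Q)`: its objects are those of `C`, its
morphisms `a → b` are the morphisms `F a → F b` of the form `F g`. -/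
structure ImageBase (F : Hom X Y) : Type u where
  of ::
  as : X.base

namespace ImageBase

variable {F : Hom X Y}

instance : Category.{v} (ImageBase F) where
  Hom a b := { f : F.o.obj a.as ⟶ F.o.obj b.as // ∃ g : a.as ⟶ b.as, F.o.map g = f }
  id a := ⟨𝟙 _, 𝟙 _, F.o.map_id _⟩
  comp f g := ⟨f.1 ≫ g.1, by
    obtain ⟨_, f, rfl⟩ := f
    obtain ⟨_, g, rfl⟩ := g
    exact ⟨f ≫ g, F.o.map_comp f g⟩⟩
  id_comp f := Subtype.ext (Category.id_comp f.1)
  comp_id f := Subtype.ext (Category.comp_id f.1)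
  assoc f g h := Subtype.ext (Category.assoc f.1 g.1 h.1)

variable (F) in
/-- The full functor from `C` to the base category of the image. -/
abbrev quot : X.base ⥤ ImageBase F where
  obj := of
  map g := ⟨F.o.map g, g, rfl⟩
  map_id a := Subtype.ext (F.o.map_id a)
  map_comp f g := Subtype.ext (F.o.map_comp f g)

variable (F) in
/-- The faithful functor from the base category of the image to `D`. -/
abbrev incl : ImageBase F ⥤ Y.base where
  obj a := F.o.obj a.as
  map f := f.1

instance : (incl F).Faithful := ⟨fun h => Subtype.ext h⟩

instance : (quot F).Full := ⟨fun ⟨_, g, h⟩ => ⟨g, Subtype.ext h⟩⟩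

/-- The pairing of morphisms in the base category of the image. -/
noncomputable def pair {t : ImageBase F} {a b : X.base} (f : t ⟶ of a) (g : t ⟶ of b) :
    t ⟶ of (a ⊗ b) :=
  ⟨lift (X := F.o.obj a) (Y := F.o.obj b) f.1 g.1 ≫ inv (prodComparison F.o a b), by
    obtain ⟨_, f, rfl⟩ := f
    obtain ⟨_, g, rfl⟩ := g
    -- Pairing any chosen preimages in `C` gives a preimage of the pairing.
    refine ⟨lift f g, ?_⟩
    rw [IsIso.eq_comp_inv]
    apply CartesianMonoidalCategory.hom_ext <;> simp [← Functor.map_comp]⟩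

theorem pair_fst {t : ImageBase F} {a b : X.base} (f : t ⟶ of a) (g : t ⟶ of b) :
    pair f g ≫ (quot F).map (fst a b) = f :=
  Subtype.ext <| (Category.assoc _ _ _).trans <|
    (congrArg _ (inv_prodComparison_map_fst F.o a b)).trans (lift_fst _ _)

theorem pair_snd {t : ImageBase F} {a b : X.base} (f : t ⟶ of a) (g : t ⟶ of b) :
    pair f g ≫ (quot F).map (snd a b) = g :=
  Subtype.ext <| (Category.assoc _ _ _).trans <|
    (congrArg _ (inv_prodComparison_map_snd F.o a b)).trans (lift_snd _ _)

/-- The comparison of `F` is invertible, hence mono, so an arrow into `F (a ⊗ b)` is determined by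
its composites with the images of the projections. -/
theorem hom_ext_of_comp {t : ImageBase F} {a b : X.base} {f g : t ⟶ of (a ⊗ b)}
    (h₁ : f ≫ (quot F).map (fst a b) = g ≫ (quot F).map (fst a b))
    (h₂ : f ≫ (quot F).map (snd a b) = g ≫ (quot F).map (snd a b)) : f = g := by
  have h₁' : f.1 ≫ F.o.map (fst a b) = g.1 ≫ F.o.map (fst a b) := congrArg Subtype.val h₁
  have h₂' : f.1 ≫ F.o.map (snd a b) = g.1 ≫ F.o.map (snd a b) := congrArg Subtype.val h₂
  have h : f.1 ≫ prodComparison F.o a b = g.1 ≫ prodComparison F.o a b := by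
    apply CartesianMonoidalCategory.hom_ext
    · simpa using h₁'
    · simpa using h₂'
  exact Subtype.ext ((cancel_mono _).1 h)

variable (F) in
/-- Products in the base category of the image are those of `C`. -/
noncomputable def isLimit (a b : X.base) :
    Limits.IsLimit (Limits.BinaryFan.mk ((quot F).map (fst a b)) ((quot F).map (snd a b))) :=
  Limits.BinaryFan.IsLimit.mk _ pair pair_fst pair_snd fun f g _ hf hg =>
    hom_ext_of_comp (hf.trans (pair_fst f g).symm) (hg.trans (pair_snd f g).symm)

variable (F) in
/-- The terminal object in the base category of the image is that of `C`. -/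
noncomputable def isTerminal : Limits.IsTerminal ((quot F).obj (𝟙_ X.base)) :=
  Limits.IsTerminal.ofUniqueHom (fun t => (quot F).map (toUnit t.as)) fun t f => by
    obtain ⟨g, rfl⟩ := (quot F).map_surjective (X := t.as) f
    exact congrArg _ (toUnit_unique _ _)

/-- With this choice `of a ⊗ of b` is definitionally `of (a ⊗ b)`, so `quot F` preserves the
designated products strictly and its comparisons are identities. -/
noncomputable instance : CartesianMonoidalCategory (ImageBase F) :=
  .ofChosenFiniteProducts ⟨_, isTerminal F⟩ fun a b => ⟨_, isLimit F a.as b.as⟩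

theorem map_lift {t a b : X.base} (f : t ⟶ a) (g : t ⟶ b) :
    (quot F).map (lift f g) =
      (lift ((quot F).map f) ((quot F).map g) : _ ⟶ (quot F).obj a ⊗ (quot F).obj b) := by
  refine hom_ext_of_comp ?_ ?_
  · exact ((quot F).map_comp _ _).symm.trans ((congrArg _ (lift_fst f g)).trans
      (lift_fst ((quot F).map f) ((quot F).map g)).symm)
  · exact ((quot F).map_comp _ _).symm.trans ((congrArg _ (lift_snd f g)).trans
      (lift_snd ((quot F).map f) ((quot F).map g)).symm)

theorem prodComparison_quot (a b : X.base) : prodComparison (quot F) a b = 𝟙 _ :=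
  CartesianMonoidalCategory.lift_fst_snd (X := (quot F).obj a) (Y := (quot F).obj b)

instance : Limits.PreservesFiniteProducts (quot F) :=
  preservesFiniteProducts_of_isIso_comparison _
    (by
      rw [show terminalComparison (quot F) = 𝟙 (𝟙_ (ImageBase F)) from toUnit_unique _ _]
      exact inferInstanceAs (IsIso (𝟙 (𝟙_ (ImageBase F)))))
    fun a b => by
      rw [prodComparison_quot]
      exact inferInstanceAs (IsIso (𝟙 ((quot F).obj a ⊗ (quot F).obj b)))

instance : Limits.PreservesFiniteProducts (incl F) :=
  have : Limits.PreservesFiniteProducts (quot F ⋙ incl F) := F.preserves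
  preservesFiniteProducts_of_comp (quot F) (incl F) fun a => ⟨a.as, rfl⟩

theorem map_whiskerRight {a b : X.base} (f : a ⟶ b) (c : X.base) :
    (quot F).map (f ▷ c) = (quot F).map f ▷ (quot F).obj c := by
  have := prodComparison_natural_whiskerRight (quot F) (B := c) f
  rw [prodComparison_quot, prodComparison_quot] at this
  exact (Category.comp_id _).symm.trans (this.trans (Category.id_comp _))

theorem map_associator_inv (a b c : X.base) :
    (quot F).map (α_ a b c).inv =
      (α_ ((quot F).obj a) ((quot F).obj b) ((quot F).obj c)).inv := by
  -- Written through pairings and projections, the associator is preserved strictly because these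
  -- are.
  have h : (α_ a b c).inv =
      lift (lift (fst a (b ⊗ c)) (snd a (b ⊗ c) ≫ fst b c)) (snd a (b ⊗ c) ≫ snd b c) := by
    apply CartesianMonoidalCategory.hom_ext
    · apply CartesianMonoidalCategory.hom_ext <;> simp
    · simp
  rw [h, map_lift]
  apply CartesianMonoidalCategory.hom_ext
  · rw [lift_fst]
    erw [map_lift]
    apply CartesianMonoidalCategory.hom_ext
    · erw [lift_fst, Category.assoc, associator_inv_fst_fst]
      rfl
    · erw [lift_snd, Category.assoc, associator_inv_fst_snd]
      exact (quot F).map_comp _ _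
  · erw [lift_snd, associator_inv_snd]
    exact (quot F).map_comp _ _

/-! ### Fibres and prop-category structure of the image -/

variable (F) in
/-- The fibres of the image are the images of the maps `P(c) → Q(F c)`. -/
def fibre : (ImageBase F)ᵒᵖ ⥤ PartOrd.{w} where
  obj c := PartOrd.of { y : Fib Y.fib (F.o.obj c.unop.as) // ∃ x, F.fibre c.unop.as x = y }
  map {d c} f := PartOrd.ofHom
    ⟨fun y => ⟨pull Y.fib f.unop.1 y.1, by
      obtain ⟨_, x, rfl⟩ := y
      obtain ⟨g, hg⟩ := f.unop.2
      exact ⟨pull X.fib g x, by rw [F.fibre_pull, hg]⟩⟩,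
    fun _ _ h => (pull Y.fib f.unop.1).monotone h⟩
  map_id c := by
    ext y
    exact pull_id Y.fib _ y.1
  map_comp f g := by
    ext y
    exact pull_comp Y.fib _ _ y.1

variable (F) in
/-- The surjection from `P(c)` to the fibre of the image. -/
def quotFib (c : X.base) : Fib X.fib c →o Fib (fibre F) (of c) :=
  ⟨fun x => ⟨F.fibre c x, x, rfl⟩, fun _ _ h => (F.fibre c).monotone h⟩

theorem quotFib_surjective (c : X.base) : Function.Surjective (quotFib F c) :=
  fun ⟨_, x, h⟩ => ⟨x, Subtype.ext h⟩

theorem pull_quotFib {c d : X.base} (f : c ⟶ d) (x : Fib X.fib d) :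
    pull (fibre F) ((quot F).map f) (quotFib F d x) = quotFib F c (pull X.fib f x) :=
  Subtype.ext (F.fibre_pull f x).symm

variable (F) in
/-- The connectives on the fibres of the image. -/
def conn (c : ImageBase F) {n : ℕ} (k : L.conn n) (y : Fin n → Fib (fibre F) c) : Fib (fibre F) c :=
  ⟨Y.str.conn (F.o.obj c.as) k fun i => (y i).1,
    -- The chosen preimages only witness membership in the image; the value itself is computed in
    -- `Y`.
    X.str.conn c.as k fun i => (y i).2.choose, by
      rw [F.map_conn]
      exact congrArg _ (funext fun i => (y i).2.choose_spec)⟩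

/-- Together with `quotFib_surjective`, this transfers laws for the connectives from `X` to the
image. -/
theorem conn_quotFib (c : X.base) {n : ℕ} (k : L.conn n) (x : Fin n → Fib X.fib c) :
    conn F (of c) k (fun i => quotFib F c (x i)) = quotFib F c (X.str.conn c k x) :=
  Subtype.ext (F.map_conn c k x).symm

variable (F) in
/-- The quantifiers on the fibres of the image. -/
noncomputable def quant (Ω : L.quant) (b c : ImageBase F) (y : Fib (fibre F) (b ⊗ c)) :
    Fib (fibre F) b :=
  ⟨Y.str.quant Ω (F.o.obj b.as) (F.o.obj c.as)
      (pull Y.fib (inv (prodComparison F.o b.as c.as)) y.1), by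
    obtain ⟨_, x, rfl⟩ := y
    exact ⟨X.str.quant Ω b.as c.as x, F.map_quant Ω b.as c.as x⟩⟩

theorem quant_quotFib (Ω : L.quant) (b c : X.base) (x : Fib X.fib (b ⊗ c)) :
    quant F Ω (of b) (of c) (quotFib F (b ⊗ c) x) = quotFib F b (X.str.quant Ω b c x) :=
  Subtype.ext (F.map_quant Ω b c x).symm

theorem conn_quotFib_pair (c : X.base) (k : L.conn 2) (x y : Fib X.fib c) :
    conn F (of c) k ![quotFib F c x, quotFib F c y] = quotFib F c (X.str.conn c k ![x, y]) := by
  rw [← conn_quotFib]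
  congr 1
  funext i
  fin_cases i <;> rfl

theorem conn_quotFib_empty (c : X.base) (k : L.conn 0) :
    conn F (of c) k ![] = quotFib F c (X.str.conn c k ![]) := by
  rw [← conn_quotFib]
  congr 1
  exact Subsingleton.elim _ _

variable (F) in
/-- The prop-category structure on the image. -/
noncomputable def str : FAStructure L (fibre F) where
  conn := conn F
  pull_conn := by
    rintro ⟨c⟩ ⟨d⟩ f n k y
    exact Subtype.ext (Y.str.pull_conn f.1 k _)
  eqP c := quotFib F (c.as ⊗ c.as) (X.str.eqP c.as)
  quant := quant F
  pull_quant := by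
    rintro Ω ⟨b⟩ ⟨b'⟩ f ⟨c⟩ y
    -- Both the arrow and the fibre element lift to `X`, where naturality is known.
    obtain ⟨f, rfl⟩ := (quot F).map_surjective (X := b) (Y := b') f
    obtain ⟨x, rfl⟩ := quotFib_surjective (b' ⊗ c) y
    have h := map_whiskerRight (F := F) f c
    rw [quant_quotFib, pull_quotFib, X.str.pull_quant, ← quant_quotFib, ← pull_quotFib, h]
  tensor_assoc := by
    rintro ⟨c⟩ x y z
    obtain ⟨x, rfl⟩ := quotFib_surjective c x
    obtain ⟨y, rfl⟩ := quotFib_surjective c y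
    obtain ⟨z, rfl⟩ := quotFib_surjective c z
    simp only [conn_quotFib_pair, X.str.tensor_assoc]
  unit_tensor := by
    rintro ⟨c⟩ x
    obtain ⟨x, rfl⟩ := quotFib_surjective c x
    simp only [conn_quotFib_empty, conn_quotFib_pair, X.str.unit_tensor]
  tensor_unit := by
    rintro ⟨c⟩ x
    obtain ⟨x, rfl⟩ := quotFib_surjective c x
    simp only [conn_quotFib_empty, conn_quotFib_pair, X.str.tensor_unit]
  quant_one := by
    rintro Ω ⟨b⟩ x
    obtain ⟨x, rfl⟩ := quotFib_surjective b x
    refine (congrArg (quant F Ω (of b) (of (𝟙_ X.base))) (pull_quotFib (fst b (𝟙_ _)) x)).trans ?_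
    rw [quant_quotFib, X.str.quant_one]
  quant_prod := by
    rintro Ω ⟨b⟩ ⟨c⟩ ⟨d⟩ x
    obtain ⟨x, rfl⟩ := quotFib_surjective ((b ⊗ c) ⊗ d) x
    have h := map_associator_inv (F := F) b c d
    -- Strict preservation of the associator turns the law into the image of the one in `X`.
    rw [← h]
    refine (congrArg (quant F Ω (of b) (of (c ⊗ d))) (pull_quotFib (α_ b c d).inv x)).trans ?_
    rw [quant_quotFib, X.str.quant_prod, ← quant_quotFib, ← quant_quotFib]
    rfl
  eqP_one := by
    refine Eq.trans ?_ (conn_quotFib_empty (𝟙_ X.base ⊗ 𝟙_ X.base) L.unit).symm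
    exact congrArg _ X.str.eqP_one
  eqP_prod := by
    rintro ⟨c⟩ ⟨d⟩
    have h₁ := map_lift (F := F) (fst (c ⊗ d) (c ⊗ d) ≫ fst c d) (snd (c ⊗ d) (c ⊗ d) ≫ fst c d)
    have h₂ := map_lift (F := F) (fst (c ⊗ d) (c ⊗ d) ≫ snd c d) (snd (c ⊗ d) (c ⊗ d) ≫ snd c d)
    rw [Functor.map_comp, Functor.map_comp] at h₁ h₂
    refine (congrArg (quotFib F ((c ⊗ d) ⊗ (c ⊗ d))) (X.str.eqP_prod c d)).trans ?_
    rw [← conn_quotFib_pair, ← pull_quotFib, ← pull_quotFib, h₁, h₂]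
    rfl

end ImageBase

open ImageBase

/-- The image of a morphism of prop-categories. -/
noncomputable def image (F : Hom X Y) : FA.{l, u, v, w} L where
  base := ImageBase F
  fib := ImageBase.fibre F
  str := ImageBase.str F

/-- The projection onto the image. -/
noncomputable def imageQuot (F : Hom X Y) : Hom X (image F) where
  o := quot F
  p :=
    { app := fun c => PartOrd.ofHom (quotFib F c.unop)
      naturality := fun d c f => by
        ext x
        exact (pull_quotFib f.unop x).symm }
  preserves := inferInstanceAs (Limits.PreservesFiniteProducts (quot F))
  map_conn c _ k x := (conn_quotFib c k x).symm
  map_quant Ω b c x := by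
    refine (quant_quotFib Ω b c x).symm.trans (congrArg (quant F Ω (of b) (of c)) ?_)
    have h : inv (prodComparison (quot F) b c) = 𝟙 _ := by
      refine IsIso.inv_eq_of_hom_inv_id ?_
      rw [prodComparison_quot]
      exact Category.comp_id _
    refine Eq.trans ?_ (congrArg (fun t => pull (fibre F) t (quotFib F (b ⊗ c) x)) h).symm
    exact (pull_id (fibre F) _ _).symm
  map_eqP c :=
    Eq.trans (pull_id (fibre F) _ (quotFib F (c ⊗ c) (X.str.eqP c))).symm
      (congrArg (fun t => pull (fibre F) t (quotFib F (c ⊗ c) (X.str.eqP c)))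
        (prodComparison_quot c c)).symm

/-- The inclusion of the image. -/
noncomputable def imageIncl (F : Hom X Y) : Hom (image F) Y where
  o := incl F
  p :=
    { app := fun _ => PartOrd.ofHom ⟨Subtype.val, fun _ _ h => h⟩
      naturality := fun _ _ _ => rfl }
  preserves := inferInstanceAs (Limits.PreservesFiniteProducts (incl F))
  -- Connectives and quantifiers of the image are restrictions of those of `Y`. Its equality
  -- elements are images of those of `X`, so their condition is that of `F`.
  map_conn _ _ _ _ := rfl
  map_quant _ _ _ _ := rfl
  map_eqP c := F.map_eqP c.as

theorem imageQuot_isCover (F : Hom X Y) : (imageQuot F).IsCover where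
  bijective := ⟨fun _ _ h => congrArg ImageBase.as h, fun a => ⟨a.as, rfl⟩⟩
  full := inferInstanceAs (quot F).Full
  surjective := quotFib_surjective

theorem imageIncl_isSub (F : Hom X Y) : (imageIncl F).IsSub where
  faithful := inferInstanceAs (incl F).Faithful
  le_iff _ _ _ := Iff.rfl

theorem imageQuot_comp_imageIncl (F : Hom X Y) : (imageQuot F).comp (imageIncl F) = F := rfl

end FA

/-! ### The factorization system on the sound prop-categories -/

variable {L : FOLanguage.{l}} (ℒ : Logic.{l, s} L)

theorem classE_iff {X Y : FASub.{l, s, u, v, w} ℒ} (F : X ⟶ Y) :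
    classE ℒ F ↔ FA.Hom.IsCover F.hom :=
  ⟨fun h => ⟨h.1, h.2.1, h.2.2⟩, fun h => ⟨h.1, h.2, h.3⟩⟩

theorem classM_iff {X Y : FASub.{l, s, u, v, w} ℒ} (F : X ⟶ Y) :
    classM ℒ F ↔ FA.Hom.IsSub F.hom :=
  ⟨fun h => ⟨h.1, h.2⟩, fun h => ⟨h.1, h.2⟩⟩

theorem isCover_isSub_of_isIso {X Y : FASub.{l, s, u, v, w} ℒ} (F : X ⟶ Y) [IsIso F] :
    FA.Hom.IsCover F.hom ∧ FA.Hom.IsSub F.hom :=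
  FA.Hom.isCover_isSub_of_inverse (congrArg (·.hom) (IsIso.hom_inv_id F))
    (congrArg (·.hom) (IsIso.inv_hom_id F))

end PropLogic

theorem mainTheorem11 {L : PropLogic.FOLanguage.{l}} (ℒ : PropLogic.Logic.{l, s} L) :
    PropLogic.IsOrthogonalFactorizationSystem
      (PropLogic.classE.{l, s, u, v, w} ℒ) (PropLogic.classM.{l, s, u, v, w} ℒ) where
  iso_left _ _ F hF := (PropLogic.classE_iff ℒ F).2 <| by
    have : CategoryTheory.IsIso F := hF
    exact (PropLogic.isCover_isSub_of_isIso ℒ F).1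
  iso_right _ _ F hF := (PropLogic.classM_iff ℒ F).2 <| by
    have : CategoryTheory.IsIso F := hF
    exact (PropLogic.isCover_isSub_of_isIso ℒ F).2
  comp_left := ⟨fun F G hF hG => (PropLogic.classE_iff ℒ _).2 <|
    PropLogic.FA.Hom.IsCover.comp ((PropLogic.classE_iff ℒ F).1 hF)
      ((PropLogic.classE_iff ℒ G).1 hG)⟩
  comp_right := ⟨fun F G hF hG => (PropLogic.classM_iff ℒ _).2 <|
    PropLogic.FA.Hom.IsSub.comp ((PropLogic.classM_iff ℒ F).1 hF)
      ((PropLogic.classM_iff ℒ G).1 hG)⟩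
  factorization {X Y} F :=
    ⟨⟨PropLogic.FA.image F.hom, .of_isSub (PropLogic.FA.imageIncl_isSub F.hom) Y.property⟩,
      CategoryTheory.ObjectProperty.homMk (PropLogic.FA.imageQuot F.hom),
      CategoryTheory.ObjectProperty.homMk (PropLogic.FA.imageIncl F.hom),
      (PropLogic.classE_iff ℒ _).2 (PropLogic.FA.imageQuot_isCover F.hom),
      (PropLogic.classM_iff ℒ _).2 (PropLogic.FA.imageIncl_isSub F.hom),
      CategoryTheory.ObjectProperty.hom_ext _ (PropLogic.FA.imageQuot_comp_imageIncl F.hom)⟩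
  exists_unique e m e' m' f g he _ _ hm' h := by
    -- The required map is the diagonal of the square from `e` to `m'` whose other sides are `f ≫
    -- e'` and `m ≫ g`.
    obtain ⟨K, hK, hu⟩ := PropLogic.FA.Hom.existsUnique_lift ((PropLogic.classE_iff ℒ e).1 he)
      ((PropLogic.classM_iff ℒ m').1 hm') (f.hom.comp e'.hom) (m.hom.comp g.hom)
      (congrArg (·.hom) h)
    refine ⟨CategoryTheory.ObjectProperty.homMk K, ⟨?_, ?_⟩, fun K' hK' => ?_⟩
    · exact CategoryTheory.ObjectProperty.hom_ext _ hK.1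
    · exact CategoryTheory.ObjectProperty.hom_ext _ hK.2
    · exact CategoryTheory.ObjectProperty.hom_ext _
        (hu K'.hom ⟨congrArg (·.hom) hK'.1, congrArg (·.hom) hK'.2⟩)
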